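/- Let $\Bbbk$ be a commutative unital ring. For integers $n\geq 0$ and $d\geq 2$ let $NC_A(n,d)$ be the unital associative $\Bbbk$-algebra generated by $T_1,\dots,T_n$ with relations $T_iT_{i+1}T_i=T_{i+1}T_iT_{i+1}$ for $1\le i<n$, $T_iT_j=T_jT_i$ for $|i-j|>1$, $T_i^2=0$ for $1\le i\le n-1$, and (if $n\ge 1$) $T_n^d=0$. Let $\mathcal A_j:=NC_A(j,2)$ for $j\ge 0$ be the usual type-$A$ nil-Coxeter algebra, so that $\mathcal A_0=\Bbbk$, and put $\mathcal A_{-1}:=\Bbbk$. The algebra $\mathcal A_{n-2}$ acts on $\mathcal A_{n-1}$, and $\mathcal A_{n-1}$ acts on $NC_A(n,d)$, by left and right multiplication through the homomorphisms $T_i\mapsto T_i$. **Proposition.** For all $n\geq 1$ and $d\geq 2$ there is an isomorphism of $\mathcal A_{n-1}$-bimodules $$NC_A(n,d)\;\simeq\;\mathcal A_{n-1}\oplus\bigoplus_{k=1}^{d-1}\bigl(\mathcal A_{n-1}\otimes_{\mathcal A_{n-2}}\mathcal A_{n-1}\bigr).$$ In Khovanov's categorification of the Weyl algebra, where $\partial$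 is represented by the restriction functor $\mathrm{Res}$ from left $\mathcal A_{n-1}$-modules to left $\mathcal A_{n-2}$-modules, and $x$ by the induction functor $\mathrm{Ind}=\mathcal A_{n-1}\otimes_{\mathcal A_{n-2}}-$, the bimodule $NC_A(n,d)$ corresponds to $1+(d-1)x\partial$: there is an isomorphism of $\mathcal A_{n-1}$-modules $$NC_A(n,d)\otimes_{\mathcal A_{n-1}}N\;\simeq\;N\oplus\bigoplus_{k=1}^{d-1}\mathrm{Ind}(\mathrm{Res}\,N),$$ natural in the left $\mathcal A_{n-1}$-module $N$. -/

import Mathlib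

open scoped TensorProduct

universe u w

section NilCoxeter

/-- The defining relations of `NC_A(n,d)`. The generator `T_{i+1}` is indexed by `i : Fin n`, so that
the last generator `T_n` has index `i` with `i + 1 = n`. -/
inductive NilCoxeterRel (k : Type u) [CommRing k] (n d : ℕ) :
    FreeAlgebra k (Fin n) → FreeAlgebra k (Fin n) → Prop
  | braid (i j : Fin n) (h : (i : ℕ) + 1 = j) :
      NilCoxeterRel k n d
        (FreeAlgebra.ι k i * FreeAlgebra.ι k j * FreeAlgebra.ι k i)
        (FreeAlgebra.ι k j * FreeAlgebra.ι k i * FreeAlgebra.ι k j)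
  | comm (i j : Fin n) (h : (i : ℕ) + 1 < j) :
      NilCoxeterRel k n d
        (FreeAlgebra.ι k i * FreeAlgebra.ι k j) (FreeAlgebra.ι k j * FreeAlgebra.ι k i)
  | sq (i : Fin n) (h : (i : ℕ) + 1 < n) :
      NilCoxeterRel k n d (FreeAlgebra.ι k i ^ 2) 0
  | last (i : Fin n) (h : (i : ℕ) + 1 = n) :
      NilCoxeterRel k n d (FreeAlgebra.ι k i ^ d) 0

/-- The generalized nil-Coxeter algebra `NC_A(n,d)` over `k`. For `n = 0` it is `k`. -/
def NCA (k : Type u) [CommRing k] (n d : ℕ) : Type u := RingQuot (NilCoxeterRel k n d)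

noncomputable instance NCA.instRing (k : Type u) [CommRing k] (n d : ℕ) : Ring (NCA k n d) :=
  inferInstanceAs (Ring (RingQuot (NilCoxeterRel k n d)))

noncomputable instance NCA.instAlgebra (k : Type u) [CommRing k] (n d : ℕ) :
    Algebra k (NCA k n d) :=
  inferInstanceAs (Algebra k (RingQuot (NilCoxeterRel k n d)))

/-- The quotient map from the free algebra. -/
noncomputable def NCA.mk (k : Type u) [CommRing k] (n d : ℕ) :
    FreeAlgebra k (Fin n) →ₐ[k] NCA k n d :=
  RingQuot.mkAlgHom k (NilCoxeterRel k n d)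

/-- The generators of `NC_A(n,d)`. -/
noncomputable def NCA.T (k : Type u) [CommRing k] (n d : ℕ) (i : Fin n) : NCA k n d :=
  NCA.mk k n d (FreeAlgebra.ι k i)

theorem NCA.mk_rel {k : Type u} [CommRing k] {n d : ℕ} {x y : FreeAlgebra k (Fin n)}
    (h : NilCoxeterRel k n d x y) : NCA.mk k n d x = NCA.mk k n d y :=
  RingQuot.mkAlgHom_rel k h

/-- The usual type-`A` nil-Coxeter algebra `𝒜_j = NC_A(j,2)`, with `j` generators. -/
abbrev UsualNCA (k : Type u) [CommRing k] (j : ℕ) : Type u := NCA k j 2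

/-- The homomorphism `𝒜_m → NC_A(n,d)` with `T_i ↦ T_i` for `1 ≤ i ≤ m`. It exists when `m < n`, and
also when `m = n` and `d = 2`. -/
noncomputable def NCA.incl (k : Type u) [CommRing k] (m n d : ℕ) (hmn : m ≤ n)
    (h : m < n ∨ d = 2) : UsualNCA k m →ₐ[k] NCA k n d :=
  RingQuot.liftAlgHom k
    ⟨FreeAlgebra.lift k fun i : Fin m => NCA.T k n d (Fin.castLE hmn i), by
      have key : ∀ i : Fin m, NCA.T k n d (Fin.castLE hmn i) ^ 2 = 0 := by
        intro i
        by_cases hi : (i : ℕ) + 1 < n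
        · simpa [NCA.T] using NCA.mk_rel (NilCoxeterRel.sq (k := k) (d := d) (Fin.castLE hmn i) hi)
        · have hi' : (i : ℕ) + 1 = n := by omega
          have hd : d = 2 := by omega
          subst hd
          simpa [NCA.T] using
            NCA.mk_rel (NilCoxeterRel.last (k := k) (d := 2) (Fin.castLE hmn i) hi')
      intro x y hxy
      cases hxy with
      | braid i j hij =>
        simpa [NCA.T] using NCA.mk_rel
          (NilCoxeterRel.braid (k := k) (d := d) (Fin.castLE hmn i) (Fin.castLE hmn j) hij)
      | comm i j hij =>
        simpa [NCA.T] using NCA.mk_rel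
          (NilCoxeterRel.comm (k := k) (d := d) (Fin.castLE hmn i) (Fin.castLE hmn j) hij)
      | sq i hi => simpa using key i
      | last i hi => simpa using key i⟩

theorem NCA.incl_T (k : Type u) [CommRing k] (m n d : ℕ) (hmn : m ≤ n) (h : m < n ∨ d = 2)
    (i : Fin m) : NCA.incl k m n d hmn h (NCA.T k m 2 i) = NCA.T k n d (Fin.castLE hmn i) := by
  unfold NCA.incl NCA.T NCA.mk
  erw [RingQuot.liftAlgHom_mkAlgHom_apply]
  simp

end NilCoxeter

section Bimodules

/-- Given ring homomorphisms `f : R → C` and `g : S → C`, the ring `C` regarded as an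
`(R,S)`-bimodule: `r · c = f r * c` and `c · s = c * g s`. Right actions are actions of the
opposite ring. -/
def BimodAlong {R S C : Type*} [Ring R] [Ring S] [Ring C] (_f : R →+* C) (_g : S →+* C) :=
  C

namespace BimodAlong

variable {R S C : Type*} [Ring R] [Ring S] [Ring C] (f : R →+* C) (g : S →+* C)

instance instAddCommGroup : AddCommGroup (BimodAlong f g) := inferInstanceAs (AddCommGroup C)

/-- The element `c : C`, seen in the bimodule. -/
def of (c : C) : BimodAlong f g := c

instance instLeft : Module R (BimodAlong f g) := Module.compHom C f

instance instRight : Module Sᵐᵒᵖ (BimodAlong f g) := Module.compHom C g.op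

theorem smul_of (r : R) (c : C) : r • of f g c = of f g (f r * c) := rfl

theorem op_smul_of (s : S) (c : C) : MulOpposite.op s • of f g c = of f g (c * g s) := rfl

instance instBimod : SMulCommClass R Sᵐᵒᵖ (BimodAlong f g) where
  smul_comm r s c := (mul_assoc (f r) (show C from c) (g s.unop)).symm

instance instBimod' : SMulCommClass Sᵐᵒᵖ R (BimodAlong f g) := SMulCommClass.symm _ _ _

end BimodAlong

/-- Restriction of scalars of a left module along `f : R → C`. -/
def ResModule {R C : Type*} [Ring R] [Ring C] (_f : R →+* C) (N : Type*) := N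

namespace ResModule

variable {R C : Type*} [Ring R] [Ring C] (f : R →+* C)

instance instAddCommGroup (N : Type*) [AddCommGroup N] : AddCommGroup (ResModule f N) :=
  inferInstanceAs (AddCommGroup N)

instance instModule (N : Type*) [AddCommGroup N] [Module C N] : Module R (ResModule f N) :=
  Module.compHom N f

/-- Restriction of scalars on morphisms. -/
def map {N N' : Type*} [AddCommGroup N] [Module C N] [AddCommGroup N'] [Module C N']
    (φ : N →ₗ[C] N') : ResModule f N →ₗ[R] ResModule f N' where
  toFun := φ
  map_add' := φ.map_add
  map_smul' r x := φ.map_smul (f r) x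

end ResModule

/-- The subgroup of `M ⊗_ℤ N` generated by the elements `m s ⊗ n - m ⊗ s n`. -/
def balancedSubgroup (S M N : Type*) [Ring S] [AddCommGroup M] [Module Sᵐᵒᵖ M] [AddCommGroup N]
    [Module S N] : AddSubgroup (M ⊗[ℤ] N) :=
  AddSubgroup.closure {z | ∃ (m : M) (s : S) (x : N),
    z = (MulOpposite.op s • m) ⊗ₜ[ℤ] x - m ⊗ₜ[ℤ] (s • x)}

/-- The tensor product `M ⊗_S N` of a right `S`-module `M` and a left `S`-module `N` over a ring `S`
that need not be commutative. -/
def BalTensor (S M N : Type*) [Ring S] [AddCommGroup M] [Module Sᵐᵒᵖ M] [AddCommGroup N]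
    [Module S N] := (M ⊗[ℤ] N) ⧸ balancedSubgroup S M N

namespace BalTensor

variable (S : Type*) [Ring S]
variable {M M' : Type*} [AddCommGroup M] [Module Sᵐᵒᵖ M] [AddCommGroup M'] [Module Sᵐᵒᵖ M']
variable {N N' : Type*} [AddCommGroup N] [Module S N] [AddCommGroup N'] [Module S N']

instance instAddCommGroup : AddCommGroup (BalTensor S M N) :=
  inferInstanceAs (AddCommGroup ((M ⊗[ℤ] N) ⧸ balancedSubgroup S M N))

/-- The projection from the tensor product over `ℤ`. -/
def proj : M ⊗[ℤ] N →+ BalTensor S M N := QuotientAddGroup.mk' (balancedSubgroup S M N)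

/-- The pure tensor `m ⊗ n`. -/
def tmul (m : M) (x : N) : BalTensor S M N := proj S (m ⊗ₜ[ℤ] x)

theorem smul_tmul (s : S) (m : M) (x : N) :
    tmul S (MulOpposite.op s • m) x = tmul S m (s • x) := by
  rw [← sub_eq_zero]
  unfold tmul
  rw [← map_sub]
  exact (QuotientAddGroup.eq_zero_iff _).2 (AddSubgroup.subset_closure ⟨m, s, x, rfl⟩)

theorem add_tmul (m m' : M) (x : N) : tmul S (m + m') x = tmul S m x + tmul S m' x := by
  simp [tmul, TensorProduct.add_tmul]

theorem tmul_add (m : M) (x x' : N) : tmul S m (x + x') = tmul S m x + tmul S m x' := by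
  simp [tmul, TensorProduct.tmul_add]

@[elab_as_elim]
theorem induction_on {P : BalTensor S M N → Prop} (z : BalTensor S M N)
    (zero : P 0) (tmul : ∀ m x, P (tmul S m x)) (add : ∀ a b, P a → P b → P (a + b)) : P z := by
  obtain ⟨t, rfl⟩ : ∃ t, proj S t = z := QuotientAddGroup.mk'_surjective _ z
  induction t using TensorProduct.induction_on with
  | zero => rw [map_zero]; exact zero
  | tmul m x => exact tmul m x
  | add a b ha hb => rw [map_add]; exact add _ _ ha hb

/-- Functoriality of `M ⊗_S N` in both variables: `m ⊗ n ↦ φ m ⊗ ψ n`. -/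
def map (φ : M →ₗ[Sᵐᵒᵖ] M') (ψ : N →ₗ[S] N') : BalTensor S M N →+ BalTensor S M' N' :=
  QuotientAddGroup.lift (balancedSubgroup S M N)
    ((proj S).comp
      (TensorProduct.map φ.toAddMonoidHom.toIntLinearMap
        ψ.toAddMonoidHom.toIntLinearMap).toAddMonoidHom)
    (by
      unfold balancedSubgroup
      rw [AddSubgroup.closure_le]
      rintro z ⟨m, s, x, rfl⟩
      have h := smul_tmul S s (φ m) (ψ x)
      rw [← sub_eq_zero] at h
      simpa [tmul] using h)

theorem map_tmul (φ : M →ₗ[Sᵐᵒᵖ] M') (ψ : N →ₗ[S] N') (m : M) (x : N) :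
    map S φ ψ (tmul S m x) = tmul S (φ m) (ψ x) := rfl

/-- If `M` is an `(R,S)`-bimodule, then `M ⊗_S N` is a left `R`-module: `r (m ⊗ n) = r m ⊗ n`. -/
instance instLeft {R : Type*} [Ring R] [Module R M] [SMulCommClass R Sᵐᵒᵖ M] :
    Module R (BalTensor S M N) where
  smul r := map S (DistribSMul.toLinearMap Sᵐᵒᵖ M r) LinearMap.id
  one_smul z := by
    change map S _ _ z = z
    induction z using induction_on with
    | zero => simp
    | tmul m x => simp [map_tmul]
    | add a b ha hb => rw [map_add, ha, hb]
  mul_smul r r' z := by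
    change map S _ _ z = map S _ _ (map S _ _ z)
    induction z using induction_on with
    | zero => simp
    | tmul m x => simp [map_tmul, mul_smul]
    | add a b ha hb => rw [map_add, ha, hb, map_add, map_add]
  smul_zero r := map_zero _
  smul_add r := map_add _
  add_smul r r' z := by
    change map S _ _ z = map S _ _ z + map S _ _ z
    induction z using induction_on with
    | zero => simp
    | tmul m x => simp [map_tmul, add_smul, add_tmul]
    | add a b ha hb => rw [map_add, ha, hb, map_add, map_add]; abel
  zero_smul z := by
    change map S _ _ z = 0
    induction z using induction_on with
    | zero => simp
    | tmul m x =>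
      have h : tmul S (0 : M) x = 0 := by simp [tmul]
      simp [map_tmul, h]
    | add a b ha hb => rw [map_add, ha, hb, add_zero]

theorem left_smul_tmul {R : Type*} [Ring R] [Module R M] [SMulCommClass R Sᵐᵒᵖ M] (r : R) (m : M)
    (x : N) : r • tmul S m x = tmul S (r • m) x := rfl

/-- If `N` is an `(S,R)`-bimodule, then `M ⊗_S N` is a right `R`-module: `(m ⊗ n) r = m ⊗ n r`. -/
instance instRight {R : Type*} [Ring R] [Module Rᵐᵒᵖ N] [SMulCommClass Rᵐᵒᵖ S N] :
    Module Rᵐᵒᵖ (BalTensor S M N) where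
  smul r := map S LinearMap.id (DistribSMul.toLinearMap S N r)
  one_smul z := by
    change map S _ _ z = z
    induction z using induction_on with
    | zero => simp
    | tmul m x => simp [map_tmul]
    | add a b ha hb => rw [map_add, ha, hb]
  mul_smul r r' z := by
    change map S _ _ z = map S _ _ (map S _ _ z)
    induction z using induction_on with
    | zero => simp
    | tmul m x => simp [map_tmul, mul_smul]
    | add a b ha hb => rw [map_add, ha, hb, map_add, map_add]
  smul_zero r := map_zero _
  smul_add r := map_add _
  add_smul r r' z := by
    change map S _ _ z = map S _ _ z + map S _ _ z
    induction z using induction_on with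
    | zero => simp
    | tmul m x => simp [map_tmul, add_smul, tmul_add]
    | add a b ha hb => rw [map_add, ha, hb, map_add, map_add]; abel
  zero_smul z := by
    change map S _ _ z = 0
    induction z using induction_on with
    | zero => simp
    | tmul m x =>
      have h : tmul S m (0 : N) = 0 := by simp [tmul]
      simp [map_tmul, h]
    | add a b ha hb => rw [map_add, ha, hb, add_zero]

theorem right_smul_tmul {R : Type*} [Ring R] [Module Rᵐᵒᵖ N] [SMulCommClass Rᵐᵒᵖ S N] (r : Rᵐᵒᵖ)
    (m : M) (x : N) : r • tmul S m x = tmul S m (r • x) := rfl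

end BalTensor

end Bimodules

section Khovanov

/-- The homomorphism `𝒜_{n-1} → NC_A(n,d)`, `T_i ↦ T_i`, for `n ≥ 1`. -/
noncomputable def topIncl (k : Type u) [CommRing k] (n d : ℕ) (hn : 1 ≤ n) :
    UsualNCA k (n - 1) →+* NCA k n d :=
  (NCA.incl k (n - 1) n d (Nat.sub_le n 1) (Or.inl (by omega))).toRingHom

/-- The homomorphism `𝒜_{n-2} → 𝒜_{n-1}`, `T_i ↦ T_i`. For `n = 1` it is the identity of `k`:
the truncated subtraction gives `𝒜_{-1} = 𝒜_0 = k`, the algebra without generators. -/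
noncomputable def subIncl (k : Type u) [CommRing k] (n : ℕ) :
    UsualNCA k (n - 2) →+* UsualNCA k (n - 1) :=
  (NCA.incl k (n - 2) (n - 1) 2 (by omega) (Or.inr rfl)).toRingHom

/-- `NC_A(n,d)` as an `𝒜_{n-1}`-bimodule. -/
abbrev NCABimod (k : Type u) [CommRing k] (n d : ℕ) (hn : 1 ≤ n) : Type u :=
  BimodAlong (topIncl k n d hn) (topIncl k n d hn)

/-- `𝒜_{n-1}` as an `(𝒜_{n-1}, 𝒜_{n-2})`-bimodule (the bimodule of induction, `x`). -/
abbrev XBimod (k : Type u) [CommRing k] (n : ℕ) : Type u :=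
  BimodAlong (RingHom.id (UsualNCA k (n - 1))) (subIncl k n)

/-- `𝒜_{n-1}` as an `(𝒜_{n-2}, 𝒜_{n-1})`-bimodule (the bimodule of restriction, `∂`). -/
abbrev DBimod (k : Type u) [CommRing k] (n : ℕ) : Type u :=
  BimodAlong (subIncl k n) (RingHom.id (UsualNCA k (n - 1)))

/-- The `𝒜_{n-1}`-bimodule `𝒜_{n-1} ⊗_{𝒜_{n-2}} 𝒜_{n-1}`. -/
abbrev XDBimod (k : Type u) [CommRing k] (n : ℕ) : Type u :=
  BalTensor (UsualNCA k (n - 2)) (XBimod k n) (DBimod k n)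

/-- The left `𝒜_{n-1}`-module `Ind (Res N) = 𝒜_{n-1} ⊗_{𝒜_{n-2}} N` of a left `𝒜_{n-1}`-module `N`:
the value at `N` of the functor `x ∂`. -/
abbrev IndRes (k : Type u) [CommRing k] (n : ℕ) (N : Type w) [AddCommGroup N]
    [Module (UsualNCA k (n - 1)) N] : Type (max u w) :=
  BalTensor (UsualNCA k (n - 2)) (XBimod k n) (ResModule (subIncl k n) N)

/-- The functor `Ind ∘ Res` on morphisms. -/
noncomputable abbrev IndRes.map (k : Type u) [CommRing k] (n : ℕ) {N N' : Type w} [AddCommGroup N]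
    [Module (UsualNCA k (n - 1)) N] [AddCommGroup N'] [Module (UsualNCA k (n - 1)) N']
    (f : N →ₗ[UsualNCA k (n - 1)] N') : IndRes k n N →+ IndRes k n N' :=
  BalTensor.map (UsualNCA k (n - 2)) LinearMap.id (ResModule.map (subIncl k n) f)

/-- The left `𝒜_{n-1}`-module `NC_A(n,d) ⊗_{𝒜_{n-1}} N` of a left `𝒜_{n-1}`-module `N`. -/
abbrev NCATensor (k : Type u) [CommRing k] (n d : ℕ) (hn : 1 ≤ n) (N : Type w) [AddCommGroup N]
    [Module (UsualNCA k (n - 1)) N] : Type (max u w) :=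
  BalTensor (UsualNCA k (n - 1)) (NCABimod k n d hn) N

/-- The functor `NC_A(n,d) ⊗_{𝒜_{n-1}} -` on morphisms. -/
noncomputable abbrev NCATensor.map (k : Type u) [CommRing k] (n d : ℕ) (hn : 1 ≤ n)
    {N N' : Type w} [AddCommGroup N]
    [Module (UsualNCA k (n - 1)) N] [AddCommGroup N'] [Module (UsualNCA k (n - 1)) N']
    (f : N →ₗ[UsualNCA k (n - 1)] N') : NCATensor k n d hn N →+ NCATensor k n d hn N' :=
  BalTensor.map (UsualNCA k (n - 1)) LinearMap.id f

end Khovanov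

/-! Write A = 𝒜_{n-1}, B = 𝒜_{n-2}, R = NC_A(n,d) and τ = T_n. Since τ commutes with B, each rule x
⊗ y ↦ x τ^i y is well defined on A ⊗_B A, and together with A → R these rules give a bimodule map Ψ
from M = A ⊕ (A ⊗_B A)^{d-1} to R (`Splitting.toRing`). The point is that Ψ is bijective. To invert
it, M is made an R-module for which Ψ is R-linear; then r ↦ r·(1,0) is the inverse.

Only the action of τ has to be invented, and it is forced by a rule τ x τ = E(x) τ² + L(x) for x in
A, with E : A → B and L : A → A ⊗_B A, where y ⊗ z is read as y τ z. Moreover L(x) τ = 0 in R, so L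
matters only in the first power of τ. `Splitting` records E and L; `Splitting.IsBraided` records the
identities under which the operator `genAction` satisfies the relations of τ, and `bijective_toRing`
concludes.

The pairs (E, L) are built by induction on n (`exists_isBraided`). Bijectivity for d = 2 says 𝒜_n =
A ⊕ (A ⊗_B A). The next E is the projection to A, and the next L sends x t y to x t ⊗ t y, where t =
T_n in 𝒜_n. The main work is to check that this pair is again braided (`IsBraided.ofBijective`).

The statement on functors follows by evaluating the decomposition on a module N: right linearity of
Ψ⁻¹ is what makes the inverse descend to R ⊗_A N (`bijective_toExtLinear`). -/

/-! ### Universal property of the balanced tensor product. -/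

namespace BalTensor

variable {S : Type*} [Ring S]
variable {M : Type*} [AddCommGroup M] [Module Sᵐᵒᵖ M] {N : Type*} [AddCommGroup N] [Module S N]
variable {P : Type*} [AddCommGroup P]

/-- The universal property of `M ⊗_S N`: a biadditive balanced map induces an additive map. -/
def lift (f : M → N → P) (add_left : ∀ m m' x, f (m + m') x = f m x + f m' x)
    (add_right : ∀ m x x', f m (x + x') = f m x + f m x')
    (balanced : ∀ (s : S) m x, f (MulOpposite.op s • m) x = f m (s • x)) :
    BalTensor S M N →+ P :=
  QuotientAddGroup.lift (balancedSubgroup S M N)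
    (TensorProduct.liftAddHom
      (AddMonoidHom.mk' (fun m => AddMonoidHom.mk' (f m) (add_right m))
        fun m m' => AddMonoidHom.ext (add_left m m'))
      -- Compatibility with ℤ is automatic for maps additive in each variable.
      fun r m x => by
        have h : ∀ g : M →+ P, g (r • m) = r • g m := fun g => map_zsmul g r m
        have h' : ∀ g : N →+ P, g (r • x) = r • g x := fun g => map_zsmul g r x
        exact (h (AddMonoidHom.mk' (fun m => f m x) fun m m' => add_left m m' x)).trans
          (h' (AddMonoidHom.mk' (f m) (add_right m))).symm)
    (by
      unfold balancedSubgroup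
      rw [AddSubgroup.closure_le]
      rintro z ⟨m, s, x, rfl⟩
      rw [SetLike.mem_coe, AddMonoidHom.mem_ker, map_sub, sub_eq_zero]
      exact balanced s m x)

end BalTensor

/-! ### The bimodule A ⊗_B A and its maps x ⊗ y ↦ j(x) r j(y). -/

section InductionRestriction

variable {A B : Type*} [Ring A] [Ring B]

/-- The `A`-bimodule `A ⊗_B A` of a homomorphism `B → A`. -/
abbrev IndResBimod (ι : B →+* A) :=
  BalTensor B (BimodAlong (RingHom.id A) ι) (BimodAlong ι (RingHom.id A))

namespace IndResBimod

variable (ι : B →+* A)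

/-- The pure tensor `x ⊗ y` in `A ⊗_B A`. -/
def tm (x y : A) : IndResBimod ι :=
  BalTensor.tmul B (BimodAlong.of (RingHom.id A) ι x) (BimodAlong.of ι (RingHom.id A) y)

theorem add_tm (x x' y : A) : tm ι (x + x') y = tm ι x y + tm ι x' y :=
  BalTensor.add_tmul B (BimodAlong.of (RingHom.id A) ι x) _ _

theorem tm_add (x y y' : A) : tm ι x (y + y') = tm ι x y + tm ι x y' :=
  BalTensor.tmul_add B _ (BimodAlong.of ι (RingHom.id A) y) _

theorem tm_balanced (x y : A) (b : B) : tm ι (x * ι b) y = tm ι x (ι b * y) :=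
  BalTensor.smul_tmul B b (BimodAlong.of (RingHom.id A) ι x) (BimodAlong.of ι (RingHom.id A) y)

@[simp]
theorem smul_tm (a x y : A) : a • tm ι x y = tm ι (a * x) y := rfl

@[simp]
theorem op_smul_tm (a x y : A) : MulOpposite.op a • tm ι x y = tm ι x (y * a) := rfl

@[simp]
theorem zero_tm (y : A) : tm ι 0 y = 0 := by
  simpa using add_tm ι 0 0 y

@[simp]
theorem tm_zero (x : A) : tm ι x 0 = 0 := by
  simpa using tm_add ι x 0 0

variable {ι}

@[elab_as_elim]
theorem induction_on {P : IndResBimod ι → Prop} (z : IndResBimod ι)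
    (zero : P 0) (tm : ∀ x y, P (tm ι x y)) (add : ∀ a b, P a → P b → P (a + b)) : P z :=
  BalTensor.induction_on B z zero tm add

theorem smul_op_smul (a c : A) (z : IndResBimod ι) :
    a • MulOpposite.op c • z = MulOpposite.op c • a • z := by
  induction z using induction_on with
  | zero => simp
  | tm x y => simp
  | add y z hy hz => simp only [smul_add, hy, hz]

variable {P : Type*} [AddCommGroup P]

/-- The universal property of `A ⊗_B A`. -/
def lift (f : A → A → P) (add_left : ∀ x x' y, f (x + x') y = f x y + f x' y)
    (add_right : ∀ x y y', f x (y + y') = f x y + f x y')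
    (balanced : ∀ b x y, f (x * ι b) y = f x (ι b * y)) : IndResBimod ι →+ P :=
  BalTensor.lift (S := B) (M := BimodAlong (RingHom.id A) ι) (N := BimodAlong ι (RingHom.id A))
    f add_left add_right balanced

/-- The map `x ⊗ y ↦ j(x) r j(y)` for a homomorphism `j : A → R` and an element `r` that commutes
with the image of `B`. -/
def sandwich {R : Type*} [Ring R] (j : A →+* R) (r : R) (hr : ∀ b, r * j (ι b) = j (ι b) * r) :
    IndResBimod ι →+ R :=
  lift (fun x y => j x * r * j y) (by intros; simp [add_mul]) (by intros; simp [mul_add])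
    (by intro b x y; simp only [map_mul, mul_assoc]; rw [← mul_assoc r, hr, mul_assoc])

@[simp]
theorem sandwich_tm {R : Type*} [Ring R] (j : A →+* R) (r : R) (hr) (x y : A) :
    sandwich (ι := ι) j r hr (tm ι x y) = j x * r * j y := rfl

theorem sandwich_smul {R : Type*} [Ring R] (j : A →+* R) (r : R) (hr) (a : A) (z) :
    sandwich (ι := ι) j r hr (a • z) = j a * sandwich j r hr z := by
  induction z using induction_on with
  | zero => simp
  | tm x y => simp [mul_assoc]
  | add y z hy hz => simp only [smul_add, map_add, hy, hz, mul_add]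

theorem sandwich_op_smul {R : Type*} [Ring R] (j : A →+* R) (r : R) (hr) (a : A) (z) :
    sandwich (ι := ι) j r hr (MulOpposite.op a • z) = sandwich j r hr z * j a := by
  induction z using induction_on with
  | zero => simp
  | tm x y => simp [mul_assoc]
  | add y z hy hz => simp only [smul_add, map_add, hy, hz, add_mul]

end IndResBimod

end InductionRestriction

open IndResBimod

/-! ### Splittings (E, L) and the braid conditions on them. -/

section Splitting

variable {A B R : Type*} [Ring A] [Ring B] [Ring R]

/-- A pair of `B`-bimodule maps `A → B` and `A → A ⊗_B A` that describe how an additional generator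
`τ`, commuting with `B`, passes through the elements of `A`: `τ x τ = E(x) τ² + L(x)`, where
`y ⊗ z` in `A ⊗_B A` stands for `y τ z`. -/
structure Splitting (ι : B →+* A) where
  E : A →+ B
  L : A →+ IndResBimod ι
  E_left : ∀ b x, E (ι b * x) = b * E x
  E_right : ∀ x b, E (x * ι b) = E x * b
  L_left : ∀ b x, L (ι b * x) = ι b • L x
  L_right : ∀ x b, L (x * ι b) = MulOpposite.op (ι b) • L x
  E_one : E 1 = 1
  L_one : L 1 = 0

namespace Splitting

variable {ι : B →+* A} (s : Splitting ι)

@[simp]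
theorem E_map (b : B) : s.E (ι b) = b := by
  simpa [s.E_one] using s.E_left b 1

@[simp]
theorem L_map (b : B) : s.L (ι b) = 0 := by
  simpa [s.L_one] using s.L_left b 1

/-- The map `x ⊗ y ↦ 1 ⊗ E(x) y`. -/
def extE : IndResBimod ι →+ IndResBimod ι :=
  lift (fun x y => tm ι 1 (ι (s.E x) * y)) (by intros; simp [add_mul, tm_add])
    (by intros; simp [mul_add, tm_add]) (by intros; simp [s.E_right, mul_assoc])

/-- The map `x ⊗ y ↦ L(x) y`. -/
def extL : IndResBimod ι →+ IndResBimod ι :=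
  lift (fun x y => MulOpposite.op y • s.L x) (by intros; simp)
    (by intros; simp [add_smul]) (by intros; simp [s.L_right, mul_smul])

@[simp]
theorem extE_tm (x y : A) : s.extE (tm ι x y) = tm ι 1 (ι (s.E x) * y) := rfl

@[simp]
theorem extL_tm (x y : A) : s.extL (tm ι x y) = MulOpposite.op y • s.L x := rfl

theorem extL_op_smul (a : A) (z : IndResBimod ι) :
    s.extL (MulOpposite.op a • z) = MulOpposite.op a • s.extL z := by
  induction z using induction_on with
  | zero => simp
  | tm x y => simp [mul_smul]
  | add y z hy hz => simp only [smul_add, map_add, hy, hz]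

theorem extE_smul (b : B) (z : IndResBimod ι) : s.extE (ι b • z) = ι b • s.extE z := by
  induction z using induction_on with
  | zero => simp
  | tm x y =>
    have h := tm_balanced ι 1 (ι (s.E x) * y) b
    simp only [one_mul] at h
    simp [s.E_left, h, mul_assoc]
  | add y z hy hz => simp only [smul_add, map_add, hy, hz]

theorem extL_smul (b : B) (z : IndResBimod ι) : s.extL (ι b • z) = ι b • s.extL z := by
  induction z using induction_on with
  | zero => simp
  | tm x y => simp [s.L_left, smul_op_smul]
  | add y z hy hz => simp only [smul_add, map_add, hy, hz]

/-- Compatibility of a splitting with a set of elements `t` (the last generator, if there is one)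
for which `A` is spanned by `B` and `B t B`. -/
structure IsBraided (S : Set A) : Prop where
  E_mul : ∀ t ∈ S, ∀ x, s.E (t * x) = 0
  L_gen : ∀ t ∈ S, s.L t = tm ι t t
  sq : ∀ t ∈ S, t * t = 0
  span : ∀ x, x ∈ AddSubgroup.closure
    (Set.range ι ∪ {x | ∃ t ∈ S, ∃ b b', x = ι b * t * ι b'})
  braid : ∀ t ∈ S, ∀ x, s.extL (t • s.L x) = t • s.L (t * x)

namespace IsBraided

variable {s} {S : Set A}

/-- The spanning set is stable under negation, so no separate case for negatives is needed. -/
theorem induction (h : s.IsBraided S) {P : A → Prop} (base : ∀ b, P (ι b))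
    (gen : ∀ t ∈ S, ∀ b b', P (ι b * t * ι b')) (add : ∀ x y, P x → P y → P (x + y)) (x : A) :
    P x := by
  refine AddSubgroup.closure_induction_left (p := fun x _ => P x) ?_ ?_ ?_ (h.span x)
  · simpa using base 0
  · rintro x (⟨b, rfl⟩ | ⟨t, ht, b, b', rfl⟩) y _ hy
    exacts [add _ _ (base b) hy, add _ _ (gen t ht b b') hy]
  · rintro x (⟨b, rfl⟩ | ⟨t, ht, b, b', rfl⟩) y _ hy
    · rw [← map_neg]
      exact add _ _ (base _) hy
    · rw [← neg_mul, ← neg_mul, ← map_neg]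
      exact add _ _ (gen t ht _ b') hy

theorem E_gen (h : s.IsBraided S) {t : A} (ht : t ∈ S) : s.E t = 0 := by
  simpa using h.E_mul t ht 1

theorem L_mul_gen_mul (h : s.IsBraided S) {t : A} (ht : t ∈ S) (b b' : B) :
    s.L (ι b * t * ι b') = tm ι (ι b * t) (t * ι b') := by
  simp [s.L_right, s.L_left, h.L_gen t ht]

/-- For x = t this is L(t) t = t ⊗ t² = 0. It makes `extL` square to zero, one half of the
nilpotency of `genAction`. -/
theorem extL_L (h : s.IsBraided S) (x : A) : s.extL (s.L x) = 0 := by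
  induction x using h.induction with
  | base b => simp
  | gen t ht b b' =>
    rw [h.L_mul_gen_mul ht]
    have ht' : t * (t * ι b') = 0 := by rw [← mul_assoc, h.sq t ht, zero_mul]
    rw [extL_tm, s.L_left, h.L_gen t ht]
    simp only [smul_tm, op_smul_tm, ht', tm_zero]
  | add x y hx hy => simp [hx, hy]

theorem extL_extL (h : s.IsBraided S) (z : IndResBimod ι) : s.extL (s.extL z) = 0 := by
  induction z using induction_on with
  | zero => simp
  | tm x y => simp [extL_op_smul, h.extL_L]
  | add y z hy hz => simp [hy, hz]

theorem extE_smul_gen (h : s.IsBraided S) {t : A} (ht : t ∈ S) (z : IndResBimod ι) :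
    s.extE (t • z) = 0 := by
  induction z using induction_on with
  | zero => simp
  | tm x y => simp [h.E_mul t ht]
  | add y z hy hz => simp [hy, hz]

theorem extL_smul_extL (h : s.IsBraided S) {t : A} (ht : t ∈ S) (z : IndResBimod ι) :
    s.extL (t • s.extL z) = t • s.extL (t • z) := by
  induction z using induction_on with
  | zero => simp
  | tm x y => simp [extL_op_smul, smul_op_smul, h.braid t ht]
  | add y z hy hz => simp [hy, hz]

end IsBraided

/-! ### The operator of the new generator and its relations. -/

/-- The action of the additional generator on `A ⊕ (A ⊗_B A)^{e+1}`. -/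
def genAction (e : ℕ) :
    A × (Fin (e + 1) → IndResBimod ι) →+ A × (Fin (e + 1) → IndResBimod ι) :=
  AddMonoidHom.mk' (fun m => (0, Fin.cons (tm ι 1 m.1 + s.extL (m.2 0))
    fun i : Fin e => s.extE (m.2 i.castSucc))) (by
      rintro ⟨a, v⟩ ⟨a', v'⟩
      refine Prod.ext (by simp) (funext fun i => ?_)
      refine Fin.cases ?_ (fun i => ?_) i
      · simp only [Prod.mk_add_mk, Pi.add_apply, map_add, Fin.cons_zero, tm_add]
        abel
      · simp)

variable {e : ℕ}

theorem genAction_fst (m) : (s.genAction e m).1 = 0 := rfl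

theorem genAction_snd_zero (m) : (s.genAction e m).2 0 = tm ι 1 m.1 + s.extL (m.2 0) := rfl

theorem genAction_snd_succ (m) (i : Fin e) :
    (s.genAction e m).2 i.succ = s.extE (m.2 i.castSucc) := rfl

theorem genAction_ext {e : ℕ} {m m' : A × (Fin (e + 1) → IndResBimod ι)} (h : m.1 = m'.1)
    (h0 : m.2 0 = m'.2 0) (hs : ∀ i : Fin e, m.2 i.succ = m'.2 i.succ) : m = m' :=
  Prod.ext h (funext fun i => Fin.cases h0 hs i)

theorem genAction_smul (b : B) (m : A × (Fin (e + 1) → IndResBimod ι)) :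
    s.genAction e (ι b • m) = ι b • s.genAction e m := by
  refine genAction_ext ?_ ?_ fun i => ?_
  · simp [genAction_fst]
  · have h := tm_balanced ι 1 m.1 b
    simp only [one_mul] at h
    simp [genAction_snd_zero, extL_smul, h]
  · simp [genAction_snd_succ, extE_smul]

/-- In slot 0 the contributions of the first component agree because L(t) = t ⊗ t, and those of slot
0 because of the condition `braid`. In the higher slots both sides vanish, since E kills tA. -/
theorem genAction_braid {S : Set A} (h : s.IsBraided S) {t : A} (ht : t ∈ S)
    (m : A × (Fin (e + 1) → IndResBimod ι)) :
    s.genAction e (t • s.genAction e m) = t • s.genAction e (t • m) := by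
  refine genAction_ext ?_ ?_ fun i => ?_
  · simp [genAction_fst]
  · simp [genAction_snd_zero, genAction_fst, h.extL_smul_extL ht, h.L_gen t ht]
  · simp [genAction_snd_succ, h.extE_smul_gen ht]

/-- After one application the first component vanishes, and so does `extL` of slot 0, because L(1) =
0 and `extL` squares to zero. On such vectors the operator only moves slots upwards through `extE`,
so e + 1 further applications empty all e + 1 slots. -/
theorem genAction_iterate_eq_zero {S : Set A} (h : s.IsBraided S)
    (m : A × (Fin (e + 1) → IndResBimod ι)) : (s.genAction e)^[e + 2] m = 0 := by
  have key : ∀ j, ((s.genAction e)^[j] (s.genAction e m)).1 = 0 ∧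
      s.extL (((s.genAction e)^[j] (s.genAction e m)).2 0) = 0 ∧
      ∀ i : Fin (e + 1), (i : ℕ) < j → ((s.genAction e)^[j] (s.genAction e m)).2 i = 0 := by
    intro j
    induction j with
    | zero => exact ⟨rfl, by simp [genAction_snd_zero, h.extL_extL, s.L_one], by simp⟩
    | succ j ih =>
      rw [Function.iterate_succ_apply']
      generalize (s.genAction e)^[j] (s.genAction e m) = w at ih
      obtain ⟨h₁, h₂, h₃⟩ := ih
      have h₀ : (s.genAction e w).2 0 = 0 := by rw [genAction_snd_zero, h₁, h₂, tm_zero, add_zero]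
      refine ⟨rfl, by rw [h₀, map_zero], Fin.cases (fun _ => h₀) fun i hi => ?_⟩
      rw [genAction_snd_succ, h₃ i.castSucc (by simpa using hi), map_zero]
  rw [Function.iterate_succ_apply]
  exact Prod.ext (key (e + 1)).1 (funext fun i => (key (e + 1)).2.2 i i.2)

/-- The action of the additional generator shifts the summands. -/
theorem genAction_single (a : A) : s.genAction e (a, 0) = (0, Pi.single 0 (tm ι 1 a)) := by
  refine genAction_ext rfl ?_ fun i => ?_
  · simp [genAction_snd_zero]
  · simp [genAction_snd_succ]

/-- Since E(1) = 1 and L(1) = 0, a tensor 1 ⊗ a moves up one slot unchanged. -/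
theorem genAction_iterate_single (a : A) (i : Fin (e + 1)) :
    (s.genAction e)^[i + 1] (a, 0) = (0, Pi.single i (tm ι 1 a)) := by
  induction i using Fin.induction with
  | zero => exact s.genAction_single a
  | succ i ih =>
    rw [Fin.val_succ, Function.iterate_succ_apply', ← Fin.val_castSucc i, ih]
    refine genAction_ext rfl ?_ fun i' => ?_
    · rw [genAction_snd_zero, tm_zero, zero_add]
      by_cases hi : i.castSucc = 0
      · simp [hi, s.L_one]
      · simp [Pi.single_eq_of_ne (Ne.symm hi)]
    · rw [genAction_snd_succ]
      by_cases hi : i' = i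
      · simp [hi, s.E_one]
      · simp [hi]

/-! ### Comparison with a ring R containing the new generator. -/

theorem pow_commutes {j : A →+* R} {τ : R} (hτ : ∀ b, τ * j (ι b) = j (ι b) * τ) (i : ℕ) (b : B) :
    τ ^ i * j (ι b) = j (ι b) * τ ^ i :=
  (Commute.pow_left (show Commute τ (j (ι b)) from hτ b) i).eq

/-- The map `A ⊕ (A ⊗_B A)^{e+1} → R` that is `j` on the first summand and
`x ⊗ y ↦ j(x) τ^{i+1} j(y)` on the others. -/
def toRing (e : ℕ) (j : A →+* R) (τ : R) (hτ : ∀ b, τ * j (ι b) = j (ι b) * τ) :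
    A × (Fin (e + 1) → IndResBimod ι) →+ R :=
  AddMonoidHom.mk' (fun m => j m.1 + ∑ i : Fin (e + 1),
    sandwich j (τ ^ (i + 1 : ℕ)) (pow_commutes hτ _) (m.2 i)) (by
      intro m m'
      simp only [Prod.fst_add, Prod.snd_add, Pi.add_apply, map_add, Finset.sum_add_distrib]
      abel)

theorem toRing_apply (j : A →+* R) (τ : R) (hτ) (m) :
    toRing (ι := ι) e j τ hτ m = j m.1 + ∑ i : Fin (e + 1),
      sandwich j (τ ^ (i + 1 : ℕ)) (pow_commutes hτ _) (m.2 i) := rfl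

theorem toRing_smul (j : A →+* R) (τ : R) (hτ) (a : A) (m) :
    toRing (ι := ι) e j τ hτ (a • m) = j a * toRing e j τ hτ m := by
  simp [toRing_apply, sandwich_smul, mul_add, Finset.mul_sum]

theorem toRing_op_smul (j : A →+* R) (τ : R) (hτ) (a : A) (m) :
    toRing (ι := ι) e j τ hτ (MulOpposite.op a • m) = toRing e j τ hτ m * j a := by
  simp [toRing_apply, sandwich_op_smul, add_mul, Finset.sum_mul]

/-- The identity that E and L are designed for. On B it is commutation with τ; for x = b t b' the
braid relation gives τ x τ = b t τ t b', which is the L-term, while E(x) = 0. -/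
theorem IsBraided.map_mul_map {s : Splitting ι} {S : Set A} (h : s.IsBraided S)
    (j : A →+* R) (τ : R)
    (hτ : ∀ b, τ * j (ι b) = j (ι b) * τ) (hb : ∀ t ∈ S, τ * j t * τ = j t * τ * j t) (x : A) :
    τ * j x * τ = j (ι (s.E x)) * τ ^ 2 + sandwich j τ hτ (s.L x) := by
  induction x using h.induction with
  | base b => simp [hτ, pow_two, mul_assoc]
  | gen t ht b b' =>
    have hE : s.E (ι b * t * ι b') = 0 := by simp [s.E_right, s.E_left, h.E_gen ht]
    rw [hE, h.L_mul_gen_mul ht]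
    calc τ * j (ι b * t * ι b') * τ = (τ * j (ι b)) * j t * (j (ι b') * τ) := by
          simp only [map_mul, mul_assoc]
      _ = j (ι b) * (τ * j t * τ) * j (ι b') := by
          rw [hτ b, ← hτ b']; simp only [mul_assoc]
      _ = _ := by rw [hb t ht]; simp [mul_assoc]
  | add x y hx hy =>
    simp only [map_add, mul_add, add_mul, hx, hy]
    abel

/-- The core is t (τ t τ) = t² τ t = 0. -/
theorem IsBraided.sandwich_L_mul {s : Splitting ι} {S : Set A} (h : s.IsBraided S)
    (j : A →+* R) (τ : R)
    (hτ : ∀ b, τ * j (ι b) = j (ι b) * τ) (hb : ∀ t ∈ S, τ * j t * τ = j t * τ * j t) (x : A) :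
    sandwich j τ hτ (s.L x) * τ = 0 := by
  induction x using h.induction with
  | base b => simp
  | gen t ht b b' =>
    rw [h.L_mul_gen_mul ht, sandwich_tm]
    calc j (ι b * t) * τ * j (t * ι b') * τ
        = j (ι b) * j t * (τ * j t * (j (ι b') * τ)) := by simp only [map_mul, mul_assoc]
      _ = j (ι b) * j t * (τ * j t * τ * j (ι b')) := by rw [← hτ b']; simp only [mul_assoc]
      _ = j (ι b) * j (t * t) * (τ * j t * j (ι b')) := by
          rw [hb t ht]; simp only [map_mul, mul_assoc]
      _ = 0 := by rw [h.sq t ht]; simp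
  | add x y hx hy => simp [add_mul, hx, hy]

/-- Multiplying τ x τ = E(x) τ² + L(x) by τ^i y leaves the correction L(x) τ^i y, which dies for i >
0 by `sandwich_L_mul`. This is why `genAction` uses `extL` in slot 0 only. -/
theorem IsBraided.mul_sandwich {s : Splitting ι} {S : Set A} (h : s.IsBraided S)
    (j : A →+* R) (τ : R)
    (hτ : ∀ b, τ * j (ι b) = j (ι b) * τ) (hb : ∀ t ∈ S, τ * j t * τ = j t * τ * j t)
    (i : ℕ) (hi : ∀ b, τ ^ (i + 1) * j (ι b) = j (ι b) * τ ^ (i + 1))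
    (hi' : ∀ b, τ ^ (i + 2) * j (ι b) = j (ι b) * τ ^ (i + 2)) (z : IndResBimod ι) :
    τ * sandwich j (τ ^ (i + 1)) hi z = sandwich j (τ ^ (i + 2)) hi' (s.extE z) +
      if i = 0 then sandwich j τ hτ (s.extL z) else 0 := by
  induction z using induction_on with
  | zero => simp
  | tm x y =>
    have h₁ : τ * sandwich j (τ ^ (i + 1)) hi (tm ι x y) = (τ * j x * τ) * τ ^ i * j y := by
      rw [sandwich_tm, pow_succ']
      simp only [mul_assoc]
    have h₂ : sandwich j (τ ^ (i + 2)) hi' (s.extE (tm ι x y)) =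
        j (ι (s.E x)) * τ ^ 2 * τ ^ i * j y := by
      rw [extE_tm, sandwich_tm, map_one, one_mul, map_mul, ← mul_assoc, hi', add_comm i 2, pow_add]
      simp only [mul_assoc]
    rw [h₁, h₂, h.map_mul_map j τ hτ hb, extL_tm, sandwich_op_smul, add_mul, add_mul]
    congr 1
    obtain rfl | ⟨i, rfl⟩ : i = 0 ∨ ∃ i', i = i' + 1 := by cases i <;> simp
    · simp
    · rw [pow_succ', ← mul_assoc, h.sandwich_L_mul j τ hτ hb]
      simp
  | add y z hy hz =>
    simp only [map_add, mul_add, hy, hz]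
    split_ifs <;> abel

theorem IsBraided.toRing_genAction {s : Splitting ι} {S : Set A} (h : s.IsBraided S)
    (j : A →+* R) (τ : R)
    (hτ : ∀ b, τ * j (ι b) = j (ι b) * τ) (hb : ∀ t ∈ S, τ * j t * τ = j t * τ * j t)
    (hd : τ ^ (e + 2) = 0) (m : A × (Fin (e + 1) → IndResBimod ι)) :
    toRing e j τ hτ (s.genAction e m) = τ * toRing e j τ hτ m := by
  have hz : ∀ (r : R) (hr) (z : IndResBimod ι), r = 0 → sandwich j r hr z = 0 := by
    rintro r hr z rfl
    induction z using induction_on with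
    | zero => simp
    | tm x y => simp
    | add y z hy hz => simp [hy, hz]
  have h₁ : ∀ i : Fin (e + 1), τ * sandwich j (τ ^ (i + 1 : ℕ))
      (pow_commutes hτ _) (m.2 i) =
      sandwich j (τ ^ (i + 2 : ℕ)) (pow_commutes hτ _) (s.extE (m.2 i)) +
      if (i : ℕ) = 0 then sandwich j τ hτ (s.extL (m.2 i)) else 0 :=
    fun i => h.mul_sandwich j τ hτ hb i _ _ _
  have h₂ : (∑ i : Fin (e + 1), if (i : ℕ) = 0 then sandwich j τ hτ (s.extL (m.2 i)) else 0) =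
      sandwich j τ hτ (s.extL (m.2 0)) := by
    simp
  have h₃ : toRing e j τ hτ (s.genAction e m) = τ * j m.1 + sandwich j τ hτ (s.extL (m.2 0)) +
      ∑ i : Fin e, sandwich j (τ ^ (i + 2 : ℕ)) (pow_commutes hτ _) (s.extE (m.2 i.castSucc)) := by
    rw [toRing_apply, Fin.sum_univ_succ]
    simp only [genAction_fst, genAction_snd_zero, genAction_snd_succ, map_zero, map_add, Fin.val_zero,
      zero_add, pow_one, sandwich_tm, map_one, one_mul, Fin.val_succ, add_assoc, one_add_one_eq_two]
  -- The top slot would contribute to τ^{e+2}, which is zero; this is the term that `genAction`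
  -- drops.
  rw [h₃, toRing_apply, mul_add, Finset.mul_sum, Finset.sum_congr rfl fun i _ => h₁ i,
    Finset.sum_add_distrib, h₂, Fin.sum_univ_castSucc (n := e),
    hz (τ ^ ((Fin.last e : ℕ) + 2)) _ _ (by simpa using hd)]
  simp only [Fin.val_castSucc]
  abel

/-! ### Passing a splitting on to the next algebra. -/

/-- The map `x ⊗ y ↦ j(x) t ⊗ t j(y)`. -/
def spread (j : A →+* R) (t : R) (ht : ∀ b, t * j (ι b) = j (ι b) * t) :
    IndResBimod ι →+ IndResBimod j :=
  lift (fun x y => tm j (j x * t) (t * j y)) (by intros; simp [add_mul, add_tm])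
    (by intros; simp [mul_add, tm_add]) (by
      -- The image of b commutes with t on both sides, and it may cross the tensor sign because ι(b)
      -- lies in A.
      intro b x y
      rw [map_mul, mul_assoc, ← ht, ← mul_assoc, tm_balanced, map_mul, ← mul_assoc, ← ht, mul_assoc])

@[simp]
theorem spread_tm (j : A →+* R) (t : R) (ht) (x y : A) :
    spread (ι := ι) j t ht (tm ι x y) = tm j (j x * t) (t * j y) := rfl

theorem spread_smul (j : A →+* R) (t : R) (ht) (a : A) (z) :
    spread (ι := ι) j t ht (a • z) = j a • spread j t ht z := by
  induction z using induction_on with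
  | zero => simp
  | tm x y => simp [mul_assoc]
  | add y z hy hz => simp only [smul_add, map_add, hy, hz]

theorem spread_op_smul (j : A →+* R) (t : R) (ht) (a : A) (z) :
    spread (ι := ι) j t ht (MulOpposite.op a • z) = MulOpposite.op (j a) • spread j t ht z := by
  induction z using induction_on with
  | zero => simp
  | tm x y => simp [mul_assoc]
  | add y z hy hz => simp only [smul_add, map_add, hy, hz]

/-- The splitting of `A → R` that comes from a decomposition `R = A ⊕ A ⊗_B A`. -/
noncomputable def ofBijective (j : A →+* R) (t : R) (ht : ∀ b, t * j (ι b) = j (ι b) * t)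
    (hbij : Function.Bijective (toRing 0 j t ht)) : Splitting j :=
  let Φ := AddEquiv.ofBijective (toRing 0 j t ht) hbij
  have left (a : A) (x : R) : Φ.symm (j a * x) = a • Φ.symm x := by
    rw [AddEquiv.symm_apply_eq]
    exact ((toRing_smul j t ht a _).trans (congrArg _ (Φ.apply_symm_apply x))).symm
  have right (x : R) (a : A) : Φ.symm (x * j a) = MulOpposite.op a • Φ.symm x := by
    rw [AddEquiv.symm_apply_eq]
    exact ((toRing_op_smul j t ht a _).trans (congrArg (· * j a) (Φ.apply_symm_apply x))).symm
  have one : Φ.symm 1 = (1, 0) := by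
    rw [AddEquiv.symm_apply_eq]
    exact (by simp [toRing_apply] : (1 : R) = toRing 0 j t ht (1, 0))
  { E := (AddMonoidHom.fst _ _).comp Φ.symm.toAddMonoidHom
    -- A further generator σ commuting with A and braided with t satisfies σ (x t y) σ = x (σ t σ) y
    -- = (x t) σ (t y), whence x t ⊗ t y.
    L := (spread j t ht).comp ((Pi.evalAddMonoidHom _ 0).comp
      ((AddMonoidHom.snd _ _).comp Φ.symm.toAddMonoidHom))
    E_left := fun a x => congrArg Prod.fst (left a x)
    E_right := fun x a => congrArg Prod.fst (right x a)
    L_left := fun a x => (congrArg (fun m => spread j t ht (m.2 0)) (left a x)).trans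
      (spread_smul j t ht a _)
    L_right := fun x a => (congrArg (fun m => spread j t ht (m.2 0)) (right x a)).trans
      (spread_op_smul j t ht a _)
    E_one := congrArg Prod.fst one
    L_one := (congrArg (fun m => spread j t ht (m.2 0)) one).trans (map_zero _) }

/-- As R is spanned by A and A t A, the conditions `E_mul` and `braid` reduce to E(t a t) = 0 and
L(t a t) t = t L(t a t) for a in A. By the old spanning property a may be taken in B, where t a t =
0, or of the form b u b', where t a t = b (u t u) b'. -/
theorem IsBraided.ofBijective {s : Splitting ι} {S : Set A} (h : s.IsBraided S)
    (j : A →+* R) (t : R)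
    (ht : ∀ b, t * j (ι b) = j (ι b) * t) (hb : ∀ u ∈ S, t * j u * t = j u * t * j u)
    (hsq : t * t = 0) (hbij : Function.Bijective (toRing 0 j t ht)) :
    (Splitting.ofBijective j t ht hbij).IsBraided {t} := by
  set s' := Splitting.ofBijective j t ht hbij
  have hgen : (AddEquiv.ofBijective (toRing 0 j t ht) hbij).symm t = (0, fun _ => tm ι 1 1) := by
    rw [AddEquiv.symm_apply_eq]
    exact (by simp [toRing_apply] : t = toRing 0 j t ht (0, fun _ => tm ι 1 1))
  have hE : s'.E t = 0 := congrArg Prod.fst hgen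
  have hL : s'.L t = tm j t t :=
    (congrArg (fun m => spread j t ht (m.2 0)) hgen).trans (by simp)
  have hspan : ∀ x, x ∈ AddSubgroup.closure
      (Set.range j ∪ {x | ∃ u ∈ ({t} : Set R), ∃ a a', x = j a * u * j a'}) := by
    intro x
    obtain ⟨⟨a, v⟩, rfl⟩ := hbij.2 x
    rw [toRing_apply, Fin.sum_univ_one]
    refine add_mem (AddSubgroup.subset_closure (Or.inl ⟨a, rfl⟩)) ?_
    change sandwich j (t ^ (0 + 1)) _ (v 0) ∈ _
    induction v 0 using induction_on with
    | zero => rw [map_zero]; exact zero_mem _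
    | tm x y =>
      exact AddSubgroup.subset_closure (Or.inr ⟨t, rfl, x, y, by rw [sandwich_tm, pow_one]⟩)
    | add y z hy hz => rw [map_add]; exact add_mem hy hz
  have htb : ∀ b, t * j (ι b) * t = 0 := fun b => by rw [ht, mul_assoc, hsq, mul_zero]
  have htu : ∀ u ∈ S, ∀ b b', t * j (ι b * u * ι b') * t = j (ι b) * (j u * t * j u) * j (ι b') := by
    intro u hu b b'
    calc t * j (ι b * u * ι b') * t = (t * j (ι b)) * j u * (j (ι b') * t) := by
          simp only [map_mul, mul_assoc]
      _ = j (ι b) * (t * j u * t) * j (ι b') := by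
          rw [ht b, ← ht b']; simp only [mul_assoc]
      _ = _ := by rw [hb u hu]
  have hEt : ∀ a, s'.E (t * j a * t) = 0 := by
    intro a
    induction a using h.induction with
    | base b => simp [htb]
    | gen u hu b b' =>
      rw [htu u hu]
      simp [s'.E_right, s'.E_left, hE]
    | add x y hx hy => simp [mul_add, add_mul, hx, hy]
  -- For a = u one has L(t u t) = ut ⊗ tu, and ut ⊗ tut = ut ⊗ utu = utu ⊗ tu = tut ⊗ tu, because u
  -- lies in A and crosses the tensor sign.
  have hLt : ∀ a, MulOpposite.op t • s'.L (t * j a * t) = t • s'.L (t * j a * t) := by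
    intro a
    induction a using h.induction with
    | base b => simp [htb]
    | gen u hu b b' =>
      have h₁ : tm j (j u * t) (t * j u * t) = tm j (t * j u * t) (t * j u) := by
        rw [hb u hu, tm_balanced, mul_assoc]
      have h₂ : s'.L (t * j (ι b * u * ι b') * t) =
          j (ι b) • MulOpposite.op (j (ι b')) • tm j (j u * t) (t * j u) := by
        rw [htu u hu, s'.L_right, s'.L_left, s'.L_right, s'.L_left, hL, smul_op_smul]
        simp
      rw [h₂]
      calc MulOpposite.op t • j (ι b) • MulOpposite.op (j (ι b')) • tm j (j u * t) (t * j u)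
          = j (ι b) • tm j (j u * t) (t * j u * (j (ι b') * t)) := by
            rw [← smul_op_smul]; simp [mul_assoc]
        _ = j (ι b) • MulOpposite.op (j (ι b')) • tm j (j u * t) (t * j u * t) := by
            rw [← ht b']; simp [mul_assoc]
        _ = tm j (j (ι b) * t * (j u * t)) (t * j u * j (ι b')) := by
            rw [h₁]; simp [mul_assoc]
        _ = _ := by rw [← ht b]; simp [mul_assoc]
    | add x y hx hy => simp only [map_add, mul_add, add_mul, smul_add, hx, hy]
  have ind : ∀ {P : R → Prop}, (∀ a, P (j a)) → (∀ a a', P (j a * t * j a')) →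
      (∀ x y, P x → P y → P (x + y)) → ∀ x, P x := by
    intro P base gen add x
    refine AddSubgroup.closure_induction_left (p := fun x _ => P x) ?_ ?_ ?_ (hspan x)
    · simpa using base 0
    · rintro x (⟨b, rfl⟩ | ⟨_, rfl, b, b', rfl⟩) y _ hy
      exacts [add _ _ (base b) hy, add _ _ (gen b b') hy]
    · rintro x (⟨b, rfl⟩ | ⟨_, rfl, b, b', rfl⟩) y _ hy
      · rw [← map_neg]
        exact add _ _ (base _) hy
      · rw [← neg_mul, ← neg_mul, ← map_neg]
        exact add _ _ (gen _ b') hy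
  refine ⟨?_, ?_, ?_, hspan, ?_⟩
  · rintro _ h_mem x
    rw [Set.mem_singleton_iff.1 h_mem]
    refine ind (P := fun x => s'.E (t * x) = 0) (fun a => by rw [s'.E_right, hE, zero_mul])
      (fun a a' => ?_) (fun x y hx hy => ?_) x
    · rw [← mul_assoc, s'.E_right, ← mul_assoc, hEt, zero_mul]
    · rw [mul_add, map_add, hx, hy, add_zero]
  · rintro _ rfl
    exact hL
  · rintro _ rfl
    exact hsq
  · rintro _ h_mem x
    rw [Set.mem_singleton_iff.1 h_mem]
    refine ind (P := fun x => s'.extL (t • s'.L x) = t • s'.L (t * x)) (fun a => ?_)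
      (fun a a' => ?_) (fun x y hx hy => ?_) x
    · simp [s'.L_right, hL, hsq]
    · rw [s'.L_right, s'.L_left, hL, ← mul_assoc, s'.L_right, ← mul_assoc,
        smul_op_smul t (j a') (s'.L (t * j a * t)), ← hLt]
      simp [mul_smul, mul_assoc]
    · simp only [map_add, mul_add, smul_add, hx, hy]

end Splitting

end Splitting

/-! ### Nil-Coxeter algebras: generators, relations and modules. -/

section NilCoxeterAction

variable {k : Type u} [CommRing k]

namespace NCA

theorem algHom_ext {n d : ℕ} {P : Type*} [Semiring P] [Algebra k P] {f g : NCA k n d →ₐ[k] P}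
    (h : ∀ i, f (T k n d i) = g (T k n d i)) : f = g :=
  RingQuot.ringQuot_ext' (s := NilCoxeterRel k n d) k f g (FreeAlgebra.hom_ext (funext h))

@[elab_as_elim]
theorem induction_on {n d : ℕ} {P : NCA k n d → Prop} (y : NCA k n d)
    (base : ∀ r, P (algebraMap k _ r)) (gen : ∀ i, P (T k n d i))
    (add : ∀ x y, P x → P y → P (x + y)) (mul : ∀ x y, P x → P y → P (x * y)) : P y := by
  obtain ⟨x, rfl⟩ : ∃ x, mk k n d x = y := RingQuot.mkAlgHom_surjective k (NilCoxeterRel k n d) y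
  induction x using FreeAlgebra.induction with
  | grade0 r => rw [AlgHom.commutes]; exact base r
  | grade1 i => exact gen i
  | mul a b ha hb => rw [map_mul]; exact mul _ _ ha hb
  | add a b ha hb => rw [map_add]; exact add _ _ ha hb

theorem T_braid {n d : ℕ} (i j : Fin n) (h : (i : ℕ) + 1 = j) :
    T k n d i * T k n d j * T k n d i = T k n d j * T k n d i * T k n d j := by
  simpa [T] using mk_rel (NilCoxeterRel.braid (k := k) (d := d) i j h)

theorem T_comm {n d : ℕ} (i j : Fin n) (h : (i : ℕ) + 1 < j) :
    T k n d i * T k n d j = T k n d j * T k n d i := by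
  simpa [T] using mk_rel (NilCoxeterRel.comm (k := k) (d := d) i j h)

theorem T_sq {n d : ℕ} (i : Fin n) (h : (i : ℕ) + 1 < n) : T k n d i ^ 2 = 0 := by
  simpa [T] using mk_rel (NilCoxeterRel.sq (k := k) (d := d) i h)

theorem T_pow {n d : ℕ} (i : Fin n) (h : (i : ℕ) + 1 = n) : T k n d i ^ d = 0 := by
  simpa [T] using mk_rel (NilCoxeterRel.last (k := k) (d := d) i h)

theorem T_sq' {n : ℕ} (i : Fin n) : T k n 2 i ^ 2 = 0 := by
  by_cases h : (i : ℕ) + 1 < n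
  exacts [T_sq i h, T_pow i (by omega)]

/-- The last generator. -/
noncomputable def lastT (k : Type u) [CommRing k] (n d : ℕ) (hn : 1 ≤ n) : NCA k n d :=
  T k n d ⟨n - 1, by omega⟩

/-- The set that contains the last generator, if there is one. -/
def lastGens (k : Type u) [CommRing k] (n : ℕ) : Set (UsualNCA k n) :=
  {t | ∃ i : Fin n, (i : ℕ) + 1 = n ∧ t = T k n 2 i}

theorem topIncl_T {n d : ℕ} (hn : 1 ≤ n) (i : Fin (n - 1)) :
    topIncl k n d hn (T k (n - 1) 2 i) = T k n d (Fin.castLE (Nat.sub_le n 1) i) :=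
  incl_T k (n - 1) n d _ _ i

theorem topIncl_algebraMap {n d : ℕ} (hn : 1 ≤ n) (r : k) :
    topIncl k n d hn (algebraMap k _ r) = algebraMap k _ r :=
  AlgHom.commutes (incl k (n - 1) n d _ _) r

theorem subIncl_T {n : ℕ} (i : Fin (n - 2)) :
    subIncl k n (T k (n - 2) 2 i) = T k (n - 1) 2 (Fin.castLE (by omega) i) :=
  incl_T k (n - 2) (n - 1) 2 _ _ i

theorem subIncl_algebraMap {n : ℕ} (r : k) :
    subIncl k n (algebraMap k _ r) = algebraMap k _ r :=
  AlgHom.commutes (incl k (n - 2) (n - 1) 2 _ _) r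

theorem lastT_comm {n d : ℕ} (hn : 1 ≤ n) (b : UsualNCA k (n - 2)) :
    lastT k n d hn * topIncl k n d hn (subIncl k n b) =
      topIncl k n d hn (subIncl k n b) * lastT k n d hn := by
  induction b using induction_on with
  | base r =>
    rw [subIncl_algebraMap, topIncl_algebraMap]
    exact (Algebra.commutes r _).symm
  | gen i =>
    rw [subIncl_T, topIncl_T]
    have := i.2
    exact (T_comm _ _ (by simp; omega)).symm
  | add x y hx hy => simp only [map_add, mul_add, add_mul, hx, hy]
  | mul x y hx hy =>
    rw [map_mul, map_mul, ← mul_assoc, hx, mul_assoc, hy, mul_assoc]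

theorem lastT_braid {n d : ℕ} (hn : 1 ≤ n) : ∀ t ∈ lastGens k (n - 1),
    lastT k n d hn * topIncl k n d hn t * lastT k n d hn =
      topIncl k n d hn t * lastT k n d hn * topIncl k n d hn t := by
  rintro _ ⟨i, hi, rfl⟩
  rw [topIncl_T]
  exact (T_braid _ _ (by simpa using hi)).symm

theorem lastT_pow {n d : ℕ} (hn : 1 ≤ n) : lastT k n d hn ^ d = 0 :=
  T_pow _ (by simp; omega)

theorem gen_cases {n d : ℕ} (hn : 1 ≤ n) (i : Fin n) :
    (∃ i', T k n d i = topIncl k n d hn (T k (n - 1) 2 i')) ∨ T k n d i = lastT k n d hn := by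
  by_cases hi : (i : ℕ) < n - 1
  · exact Or.inl ⟨⟨i, hi⟩, by rw [topIncl_T]; rfl⟩
  · refine Or.inr (congrArg _ (Fin.ext ?_))
    have := i.2
    simp
    omega

/-- An `𝒜_{n-1}`-module with an operator that satisfies the relations of the last generator is an
`NC_A(n,d)`-module. -/
theorem exists_action {n d : ℕ} (hn : 1 ≤ n) {M : Type*} [AddCommGroup M]
    [Module (UsualNCA k (n - 1)) M] (F : M →+ M)
    (hF : ∀ b m, F (subIncl k n b • m) = subIncl k n b • F m)
    (hb : ∀ t ∈ lastGens k (n - 1), ∀ m, F (t • F m) = t • F (t • m))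
    (hd : ∀ m, F^[d] m = 0) :
    ∃ φ : NCA k n d →+* AddMonoid.End M,
      (∀ a m, φ (topIncl k n d hn a) m = a • m) ∧ φ (lastT k n d hn) = F := by
  -- The presentation is universal among k-algebras, so M becomes a k-module through 𝒜_{n-1}. The
  -- operator F is k-linear because scalars come from 𝒜_{n-2}.
  let _ : Module k M := Module.compHom M (algebraMap k (UsualNCA k (n - 1)))
  have : IsScalarTower k (UsualNCA k (n - 1)) M := IsScalarTower.of_algebraMap_smul fun _ _ => rfl
  let F' : Module.End k M :=
    { F with
      map_smul' := fun r m => by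
        have := hF (algebraMap k _ r) m
        rwa [subIncl_algebraMap] at this }
  let l : UsualNCA k (n - 1) →ₐ[k] Module.End k M := Algebra.lsmul k k M
  let f : Fin n → Module.End k M := fun i =>
    if h : (i : ℕ) < n - 1 then l (T k (n - 1) 2 ⟨i, h⟩) else F'
  have f_lt : ∀ (i : Fin n) (h : (i : ℕ) < n - 1), f i = l (T k (n - 1) 2 ⟨i, h⟩) :=
    fun i h => dif_pos h
  have f_last : ∀ i : Fin n, ¬ (i : ℕ) < n - 1 → f i = F' := fun i h => dif_neg h
  have hrel : ∀ ⦃x y⦄, NilCoxeterRel k n d x y → FreeAlgebra.lift k f x = FreeAlgebra.lift k f y := by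
    intro x y hxy
    cases hxy with
    | braid i j hij =>
      simp only [map_mul, FreeAlgebra.lift_ι_apply]
      by_cases hj : (j : ℕ) < n - 1
      · rw [f_lt i (by omega), f_lt j hj]
        simp only [← map_mul]
        exact congrArg l (T_braid ⟨i, _⟩ ⟨j, hj⟩ hij)
      · have hj' := j.2
        rw [f_lt i (by omega), f_last j hj]
        ext m
        exact (hb _ ⟨⟨i, by omega⟩, by simp; omega, rfl⟩ m).symm
    | comm i j hij =>
      simp only [map_mul, FreeAlgebra.lift_ι_apply]
      by_cases hj : (j : ℕ) < n - 1
      · rw [f_lt i (by omega), f_lt j hj]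
        simp only [← map_mul]
        exact congrArg l (T_comm ⟨i, _⟩ ⟨j, hj⟩ hij)
      · have hj' := j.2
        rw [f_lt i (by omega), f_last j hj]
        ext m
        -- Here j is the last index, so i + 1 < j places this generator in the image of 𝒜_{n-2}.
        have := hF (T k (n - 2) 2 ⟨i, by omega⟩) m
        rw [subIncl_T] at this
        exact this.symm
    | sq i hi =>
      simp only [map_pow, map_zero, FreeAlgebra.lift_ι_apply]
      rw [f_lt i (by omega), ← map_pow, T_sq', map_zero]
    | last i hi =>
      simp only [map_pow, map_zero, FreeAlgebra.lift_ι_apply]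
      rw [f_last i (by omega)]
      ext m
      rw [Module.End.pow_apply]
      exact hd m
  let φ : NCA k n d →ₐ[k] Module.End k M := RingQuot.liftAlgHom k ⟨FreeAlgebra.lift k f, hrel⟩
  have hφ : ∀ i, φ (T k n d i) = f i := by
    intro i
    change RingQuot.liftAlgHom k ⟨FreeAlgebra.lift k f, hrel⟩
      (RingQuot.mkAlgHom k (NilCoxeterRel k n d) (FreeAlgebra.ι k i)) = f i
    rw [RingQuot.liftAlgHom_mkAlgHom_apply, FreeAlgebra.lift_ι_apply]
  have hφl : φ.comp (incl k (n - 1) n d (Nat.sub_le n 1) (Or.inl (by omega))) = l := by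
    refine algHom_ext fun i => ?_
    rw [AlgHom.comp_apply, incl_T, hφ, f_lt _ i.2]
    rfl
  refine ⟨{ toFun := fun y => (φ y).toAddMonoidHom
            map_one' := by rw [map_one]; rfl
            map_mul' := fun x y => by rw [map_mul]; rfl
            map_zero' := by rw [map_zero]; rfl
            map_add' := fun x y => by rw [map_add]; rfl }, fun a m => ?_, ?_⟩
  · exact congrArg (fun g => g m) (AlgHom.congr_fun hφl a)
  · ext m
    exact congrArg (fun g => g m) ((hφ _).trans (f_last ⟨n - 1, by omega⟩ (by simp)))

end NCA

/-! ### Bijectivity of Ψ and existence of braided splittings. -/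

open NCA

/-- With the R-module structure given by `genAction`, Ψ is R-linear and sends (1,0) to 1, so y ↦
y·(1,0) is a right inverse. It is also a left inverse, since x τ^{i+1} y carries (1,0) to x ⊗ y in
slot i. -/
theorem Splitting.IsBraided.bijective_toRing {n e : ℕ} (hn : 1 ≤ n) {s : Splitting (subIncl k n)}
    (h : s.IsBraided (lastGens k (n - 1))) :
    Function.Bijective (Splitting.toRing e (topIncl k n (e + 2) hn) (lastT k n (e + 2) hn)
      (lastT_comm hn)) := by
  obtain ⟨φ, hφ, hφT⟩ := exists_action (d := e + 2) hn (s.genAction e) s.genAction_smul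
    (fun t ht m => s.genAction_braid h ht m) (s.genAction_iterate_eq_zero h)
  set j := topIncl k n (e + 2) hn
  set τ := lastT k n (e + 2) hn
  set Ψ := Splitting.toRing e j τ (lastT_comm hn) with hΨ
  have φ_add : ∀ x y m, φ (x + y) m = φ x m + φ y m := fun x y m => by rw [map_add]; rfl
  have φ_mul : ∀ x y m, φ (x * y) m = φ x (φ y m) := fun x y m => by rw [map_mul]; rfl
  have hpow : ∀ i m, φ (τ ^ i) m = (s.genAction e)^[i] m := by
    intro i m
    induction i with
    | zero => rw [pow_zero, map_one]; rfl
    | succ i ih =>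
      rw [pow_succ', map_mul, Function.iterate_succ_apply', ← ih, hφT]
      rfl
  have hmul : ∀ y m, Ψ (φ y m) = y * Ψ m := by
    have hj : ∀ a m, Ψ (φ (j a) m) = j a * Ψ m := fun a m => by
      rw [hφ, Splitting.toRing_smul]
    intro y
    induction y using NCA.induction_on with
    | base r =>
      rw [← topIncl_algebraMap hn]
      exact hj _
    | gen i =>
      obtain ⟨i', hi⟩ | hi := gen_cases (k := k) (d := e + 2) hn i
      · rw [hi]
        exact hj _
      · rw [hi]
        intro m
        rw [hφT]
        exact h.toRing_genAction j τ (lastT_comm hn) (lastT_braid hn) (lastT_pow hn) m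
    | add x y hx hy =>
      intro m
      rw [φ_add, map_add, hx, hy, add_mul]
    | mul x y hx hy =>
      intro m
      rw [φ_mul, hx, hy, mul_assoc]
  have hone : Ψ (1, 0) = 1 := by simp [hΨ, Splitting.toRing_apply]
  have hsand : ∀ (i : Fin (e + 1)) (z : IndResBimod (subIncl k n)),
      φ (sandwich j (τ ^ (i + 1 : ℕ)) (Splitting.pow_commutes (lastT_comm hn) _) z) (1, 0) =
        (0, Pi.single i z) := by
    intro i z
    induction z using IndResBimod.induction_on with
    | zero => simp; rfl
    | tm x y =>
      rw [sandwich_tm, φ_mul, φ_mul, hφ, hφ, hpow]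
      have : y • ((1, 0) : UsualNCA k (n - 1) × (Fin (e + 1) → IndResBimod (subIncl k n))) =
          (y, 0) := by simp
      rw [this, s.genAction_iterate_single]
      simp [← Pi.single_smul]
    | add x y hx hy =>
      rw [map_add, φ_add, hx, hy, Prod.mk_add_mk, Pi.single_add, add_zero]
  have hleft : ∀ m, φ (Ψ m) (1, 0) = m := by
    rintro ⟨a, v⟩
    have φ_sum : ∀ g : Fin (e + 1) → NCA k n (e + 2),
        φ (∑ i, g i) (1, 0) = ∑ i, φ (g i) (1, 0) := fun g =>
      map_sum (AddMonoidHom.mk' (fun y => φ y (1, 0)) fun x y => φ_add x y _) g _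
    rw [hΨ, Splitting.toRing_apply, φ_add, φ_sum, hφ, Finset.sum_congr rfl fun i _ => hsand i (v i)]
    refine Prod.ext ?_ ?_
    · simp [Prod.fst_sum]
    · simp [Prod.snd_sum, Finset.univ_sum_single]
  refine ⟨Function.LeftInverse.injective (g := fun y => φ y (1, 0)) hleft, fun y => ⟨φ y (1, 0), ?_⟩⟩
  rw [hmul, hone, mul_one]

theorem exists_isBraided (n : ℕ) (hn : 1 ≤ n) :
    ∃ s : Splitting (subIncl k n), s.IsBraided (lastGens k (n - 1)) := by
  induction n, hn using Nat.le_induction with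
  | base =>
    -- For n = 1 both algebras have no generators and the inclusion is the identity: E = id and L =
    -- 0 work, and the conditions on the last generator are vacuous.
    have hid : ∀ x, subIncl k 1 x = x := by
      have : incl k 0 0 2 le_rfl (Or.inr rfl) = AlgHom.id k _ :=
        algHom_ext fun i => i.elim0
      exact fun x => AlgHom.congr_fun this x
    have hS : ∀ t, t ∉ lastGens k (1 - 1) := by
      rintro _ ⟨i, -⟩
      exact i.elim0
    refine ⟨{ E := AddMonoidHom.id _
              L := 0
              E_left := fun b x => congrArg (· * x) (hid b)
              E_right := fun x b => congrArg (x * ·) (hid b)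
              L_left := by simp
              L_right := by simp
              E_one := rfl
              L_one := rfl }, ?_⟩
    exact
      { E_mul := fun t ht => (hS t ht).elim
        L_gen := fun t ht => (hS t ht).elim
        sq := fun t ht => (hS t ht).elim
        span := fun x => AddSubgroup.subset_closure (Or.inl ⟨x, hid x⟩)
        braid := fun t ht => (hS t ht).elim }
  | succ n hn ih =>
    obtain ⟨s, h⟩ := ih
    have hS : lastGens k n = {lastT k n 2 hn} := by
      ext t
      constructor
      · rintro ⟨i, hi, rfl⟩
        exact congrArg _ (Fin.ext (by simp; omega))
      · rintro rfl
        exact ⟨_, by simp; omega, rfl⟩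
    have := h.ofBijective (topIncl k n 2 hn) (lastT k n 2 hn) (lastT_comm hn) (lastT_braid hn)
      (by rw [← pow_two]; exact lastT_pow hn) (h.bijective_toRing hn)
    rw [← hS] at this
    -- The maps `topIncl k n 2 hn` and `subIncl k (n + 1)` agree definitionally.
    exact ⟨_, this⟩

end NilCoxeterAction

/-! ### From the bimodule decomposition to the functors on modules. -/

section Decomposition

variable {A B R : Type*} [Ring A] [Ring B] [Ring R] (ι : B →+* A) (j : A →+* R)
variable (N : Type*) [AddCommGroup N] [Module A N]

/-- The left `A`-module `A ⊗_B N` of a left `A`-module `N`. -/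
abbrev IndResModule := BalTensor B (BimodAlong (RingHom.id A) ι) (ResModule ι N)

/-- The left `A`-module `R ⊗_A N` of a left `A`-module `N`. -/
abbrev ExtModule := BalTensor A (BimodAlong j j) N

variable {N}

namespace ExtModule

/-- The pure tensor `y ⊗ v` in `R ⊗_A N`. -/
def tm (y : R) (v : N) : ExtModule j N := BalTensor.tmul A (BimodAlong.of j j y) v

theorem add_tm (y y' : R) (v : N) : tm j (y + y') v = tm j y v + tm j y' v :=
  BalTensor.add_tmul A (BimodAlong.of j j y) _ v

theorem tm_add (y : R) (v v' : N) : tm j y (v + v') = tm j y v + tm j y v' :=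
  BalTensor.tmul_add A _ v v'

theorem tm_balanced (y : R) (v : N) (a : A) : tm j (y * j a) v = tm j y (a • v) :=
  BalTensor.smul_tmul A a (BimodAlong.of j j y) v

theorem smul_tm (y : R) (v : N) (a : A) : a • tm j y v = tm j (j a * y) v := rfl

theorem zero_tm (v : N) : tm j 0 v = 0 := by
  simpa using add_tm j 0 0 v

theorem sum_tm {α : Type*} (t : Finset α) (y : α → R) (v : N) :
    tm j (∑ i ∈ t, y i) v = ∑ i ∈ t, tm j (y i) v :=
  map_sum (AddMonoidHom.mk' (fun y => tm j y v) fun y y' => add_tm j y y' v) y t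

variable {j}

@[elab_as_elim]
theorem induction_on {P : ExtModule j N → Prop} (z : ExtModule j N)
    (zero : P 0) (tm : ∀ y v, P (tm j y v)) (add : ∀ a b, P a → P b → P (a + b)) : P z :=
  BalTensor.induction_on A z zero tm add

/-- The universal property of `R ⊗_A N`. -/
def lift {P : Type*} [AddCommGroup P] (f : R → N → P)
    (add_left : ∀ x x' y, f (x + x') y = f x y + f x' y)
    (add_right : ∀ x y y', f x (y + y') = f x y + f x y')
    (balanced : ∀ a x y, f (x * j a) y = f x (a • y)) : ExtModule j N →+ P :=
  BalTensor.lift (S := A) (M := BimodAlong j j) (N := N) f add_left add_right balanced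

end ExtModule

namespace IndResModule

/-- The pure tensor `x ⊗ v` in `A ⊗_B N`. -/
def tm (x : A) (v : N) : IndResModule ι N :=
  BalTensor.tmul B (BimodAlong.of (RingHom.id A) ι x) (show ResModule ι N from v)

theorem add_tm (x x' : A) (v : N) : tm ι (x + x') v = tm ι x v + tm ι x' v :=
  BalTensor.add_tmul B (BimodAlong.of (RingHom.id A) ι x) _ _

theorem tm_add (x : A) (v v' : N) : tm ι x (v + v') = tm ι x v + tm ι x v' :=
  BalTensor.tmul_add B _ (show ResModule ι N from v) _

theorem tm_balanced (x : A) (v : N) (b : B) : tm ι (x * ι b) v = tm ι x (ι b • v) :=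
  BalTensor.smul_tmul B b (BimodAlong.of (RingHom.id A) ι x) (show ResModule ι N from v)

variable {ι}

@[elab_as_elim]
theorem induction_on {P : IndResModule ι N → Prop} (z : IndResModule ι N)
    (zero : P 0) (tm : ∀ x v, P (tm ι x v)) (add : ∀ a b, P a → P b → P (a + b)) : P z :=
  BalTensor.induction_on B z zero tm add

/-- The universal property of `A ⊗_B N`. -/
def lift {P : Type*} [AddCommGroup P] (f : A → N → P)
    (add_left : ∀ x x' y, f (x + x') y = f x y + f x' y)
    (add_right : ∀ x y y', f x (y + y') = f x y + f x y')
    (balanced : ∀ b x y, f (x * ι b) y = f x (ι b • y)) : IndResModule ι N →+ P :=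
  BalTensor.lift (S := B) (M := BimodAlong (RingHom.id A) ι) (N := ResModule ι N)
    f add_left add_right balanced

/-- The map `A ⊗_B A → A ⊗_B N`, `x ⊗ y ↦ x ⊗ y v`. -/
def eval (v : N) : IndResBimod ι →+ IndResModule ι N :=
  IndResBimod.lift (fun x y => tm ι x (y • v)) (by intros; simp [add_tm])
    (by intros; simp [add_smul, tm_add]) (by intros; simp [tm_balanced, mul_smul])

@[simp]
theorem eval_tm (v : N) (x y : A) : eval v (IndResBimod.tm ι x y) = tm ι x (y • v) := rfl

theorem eval_add (v v' : N) (z : IndResBimod ι) : eval (v + v') z = eval v z + eval v' z := by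
  induction z using IndResBimod.induction_on with
  | zero => simp
  | tm x y => simp [tm_add]
  | add y z hy hz => simp only [map_add, hy, hz]; abel

theorem eval_op_smul (v : N) (a : A) (z : IndResBimod ι) :
    eval v (MulOpposite.op a • z) = eval (a • v) z := by
  induction z using IndResBimod.induction_on with
  | zero => simp
  | tm x y => simp [mul_smul]
  | add y z hy hz => simp only [smul_add, map_add, hy, hz]

/-- The map `A ⊗_B N → R ⊗_A N`, `x ⊗ v ↦ j(x) r ⊗ v`, for an element `r` that commutes with the
image of `B`. -/
def toExt (r : R) (hr : ∀ b, r * j (ι b) = j (ι b) * r) : IndResModule ι N →+ ExtModule j N :=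
  lift (fun x v => ExtModule.tm j (j x * r) v) (by intros; simp [add_mul, ExtModule.add_tm])
    (by intros; simp [ExtModule.tm_add])
    (by intro b x v; rw [map_mul, mul_assoc, ← hr, ← mul_assoc, ExtModule.tm_balanced])

theorem toExt_tm (r : R) (hr) (x : A) (v : N) :
    toExt (ι := ι) j r hr (tm ι x v) = ExtModule.tm j (j x * r) v := rfl

theorem toExt_smul (r : R) (hr) (a : A) (z : IndResModule ι N) :
    toExt j r hr (a • z) = a • toExt j r hr z := by
  induction z using induction_on with
  | zero => simp
  | tm x v =>
    have : j (a * x) * r = j a * (j x * r) := by rw [map_mul, mul_assoc]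
    exact congrArg (ExtModule.tm j · v) this
  | add y z hy hz => simp only [smul_add, map_add, hy, hz]

theorem toExt_eval (r : R) (hr) (v : N) (z : IndResBimod ι) :
    toExt j r hr (eval v z) = ExtModule.tm j (sandwich j r hr z) v := by
  induction z using IndResBimod.induction_on with
  | zero => rw [map_zero, map_zero, map_zero, ExtModule.zero_tm]
  | tm x y => rw [eval_tm, toExt_tm, sandwich_tm, ExtModule.tm_balanced]
  | add y z hy hz => rw [map_add, map_add, map_add, hy, hz, ExtModule.add_tm]

end IndResModule

open IndResModule

namespace Splitting

variable {ι} {e : ℕ} (τ : R) (hτ : ∀ b, τ * j (ι b) = j (ι b) * τ)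

/-- The map `A ⊕ (A ⊗_B A)^{e+1} → R` as a homomorphism of left modules. -/
def toRingLinear (e : ℕ) : A × (Fin (e + 1) → IndResBimod ι) →ₗ[A] BimodAlong j j :=
  { toRing e j τ hτ with map_smul' := toRing_smul j τ hτ }

/-- The map `N ⊕ (A ⊗_B N)^{e+1} → R ⊗_A N`. -/
def toExtLinear (e : ℕ) (N : Type*) [AddCommGroup N] [Module A N] :
    N × (Fin (e + 1) → IndResModule ι N) →ₗ[A] ExtModule j N where
  toFun m := ExtModule.tm j 1 m.1 +
    ∑ i : Fin (e + 1), toExt j (τ ^ (i + 1 : ℕ)) (pow_commutes hτ _) (m.2 i)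
  map_add' m m' := by
    simp only [Prod.fst_add, Prod.snd_add, Pi.add_apply, map_add, Finset.sum_add_distrib,
      ExtModule.tm_add]
    abel
  map_smul' a m := by
    have h : ExtModule.tm j 1 (a • m.1) =
        a • ExtModule.tm j 1 m.1 := by
      rw [← ExtModule.tm_balanced, ExtModule.smul_tm, one_mul, mul_one]
    simp only [Prod.smul_fst, Prod.smul_snd, Pi.smul_apply, toExt_smul, h, smul_add,
      Finset.smul_sum, RingHom.id_apply]

theorem toExtLinear_apply (m : N × (Fin (e + 1) → IndResModule ι N)) :
    toExtLinear j τ hτ e N m = ExtModule.tm j 1 m.1 +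
      ∑ i : Fin (e + 1), toExt j (τ ^ (i + 1 : ℕ)) (pow_commutes hτ _) (m.2 i) := rfl

theorem toExtLinear_natural {N' : Type*} [AddCommGroup N'] [Module A N'] (f : N →ₗ[A] N')
    (m : N × (Fin (e + 1) → IndResModule ι N)) :
    toExtLinear j τ hτ e N' (f m.1, fun i =>
      BalTensor.map B LinearMap.id (ResModule.map ι f) (m.2 i)) =
      BalTensor.map A LinearMap.id f (toExtLinear j τ hτ e N m) := by
  have h : ∀ (r : R) (hr) (z : IndResModule ι N),
      toExt j r hr (BalTensor.map B LinearMap.id (ResModule.map ι f) z) =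
        BalTensor.map A LinearMap.id f (toExt j r hr z) := by
    intro r hr z
    induction z using IndResModule.induction_on with
    | zero => simp
    | tm x v => rfl
    | add y z hy hz => simp only [map_add, hy, hz]
  simp only [toExtLinear_apply, map_add, map_sum, h]
  rfl

/-- The inverse sends y ⊗ v to Ψ⁻¹(y) evaluated at v, by a ↦ a v and x ⊗ y ↦ x ⊗ y v. It is balanced
over A because Ψ⁻¹ is right A-linear. -/
theorem bijective_toExtLinear (hbij : Function.Bijective (toRing e j τ hτ)) :
    Function.Bijective (toExtLinear j τ hτ e N) := by
  let Φ := AddEquiv.ofBijective (toRing e j τ hτ) hbij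
  let ev : (A × (Fin (e + 1) → IndResBimod ι)) → N → N × (Fin (e + 1) → IndResModule ι N) :=
    fun m v => (m.1 • v, fun i => eval v (m.2 i))
  have hev : ∀ m v, toExtLinear j τ hτ e N (ev m v) =
      ExtModule.tm j (Φ m) v := by
    intro m v
    have : Φ m = j m.1 + ∑ i : Fin (e + 1),
      sandwich j (τ ^ (i + 1 : ℕ)) (pow_commutes hτ _) (m.2 i) := rfl
    rw [this, ExtModule.add_tm, ExtModule.sum_tm, toExtLinear_apply, ← ExtModule.tm_balanced, one_mul]
    simp only [ev, toExt_eval]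
  have right (x : R) (a : A) : Φ.symm (x * j a) = MulOpposite.op a • Φ.symm x := by
    rw [AddEquiv.symm_apply_eq]
    exact ((toRing_op_smul j τ hτ a _).trans (congrArg (· * j a) (Φ.apply_symm_apply x))).symm
  let G : ExtModule j N →+ N × (Fin (e + 1) → IndResModule ι N) :=
    ExtModule.lift (fun y v => ev (Φ.symm y) v)
      (fun y y' v => by
        refine (congrArg (ev · v) (map_add Φ.symm y y')).trans ?_
        exact Prod.ext (add_smul _ _ _) (funext fun i => map_add _ _ _))
      (fun y v v' => Prod.ext (smul_add _ _ _) (funext fun i => eval_add _ _ _))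
      (fun a y v => by
        refine (congrArg (ev · v) (right y a)).trans ?_
        exact Prod.ext (mul_smul (Φ.symm y).1 a v) (funext fun i => eval_op_smul _ _ _))
  have hG : ∀ y v, G (ExtModule.tm j y v) = ev (Φ.symm y) v :=
    fun _ _ => rfl
  have hright : ∀ z, toExtLinear j τ hτ e N (G z) = z := by
    intro z
    induction z using ExtModule.induction_on with
    | zero => simp
    | tm y v => rw [hG, hev, AddEquiv.apply_symm_apply]
    | add y z hy hz => simp only [map_add, hy, hz]
  have hone : Φ.symm 1 = (1, 0) := by
    rw [AddEquiv.symm_apply_eq]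
    exact (by simp [toRing_apply] : (1 : R) = toRing e j τ hτ (1, 0))
  have hsingle : ∀ (i : Fin (e + 1)) (x : A),
      Φ.symm (j x * τ ^ (i + 1 : ℕ)) = (0, Pi.single i (IndResBimod.tm ι x 1)) := by
    intro i x
    rw [AddEquiv.symm_apply_eq]
    refine Eq.trans ?_ (toRing_apply j τ hτ _).symm
    rw [Finset.sum_eq_single i]
    · simp
    · intro i' _ hi
      simp [Pi.single_eq_of_ne hi]
    · simp
  have hGi : ∀ (i : Fin (e + 1)) z,
      G (toExt j (τ ^ (i + 1 : ℕ)) (pow_commutes hτ _) z) = (0, Pi.single i z) := by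
    intro i z
    induction z using IndResModule.induction_on with
    | zero => simp; rfl
    | tm x v =>
      rw [toExt_tm, hG, hsingle]
      refine Prod.ext (zero_smul _ _) (funext fun i' => ?_)
      by_cases hi : i' = i
      · subst hi
        simp [ev]
      · simp [ev, Pi.single_eq_of_ne hi]
    | add y z hy hz => rw [map_add, map_add, hy, hz, Prod.mk_add_mk, Pi.single_add, add_zero]
  have hleft : ∀ m, G (toExtLinear j τ hτ e N m) = m := by
    rintro ⟨v, w⟩
    rw [toExtLinear_apply, map_add, map_sum, Finset.sum_congr rfl fun i _ => hGi i (w i), hG, hone]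
    refine Prod.ext ?_ ?_
    · simp [ev, Prod.fst_sum]
    · simp only [ev, Prod.snd_add, Prod.snd_sum, Finset.univ_sum_single]
      funext i
      simp
  exact ⟨Function.LeftInverse.injective hleft, Function.RightInverse.surjective hright⟩

end Splitting

end Decomposition

theorem mainTheorem6 (k : Type u) [CommRing k] (n d : ℕ) (hn : 1 ≤ n) (_hd : 2 ≤ d) :
    -- the isomorphism of bimodules
    (∃ φ : NCABimod k n d hn ≃ₗ[UsualNCA k (n - 1)]
        UsualNCA k (n - 1) × (Fin (d - 1) → XDBimod k n),
      ∀ (a : UsualNCA k (n - 1)) (y : NCABimod k n d hn),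
        φ (MulOpposite.op a • y) = MulOpposite.op a • φ y) ∧
    -- the isomorphism of functors `NC_A(n,d) ⊗ - ≅ 1 + (d - 1) x ∂`
    (∃ e : ∀ (N : Type w) [AddCommGroup N] [Module (UsualNCA k (n - 1)) N],
        NCATensor k n d hn N ≃ₗ[UsualNCA k (n - 1)] N × (Fin (d - 1) → IndRes k n N),
      ∀ (N N' : Type w) [AddCommGroup N] [Module (UsualNCA k (n - 1)) N] [AddCommGroup N']
        [Module (UsualNCA k (n - 1)) N'] (f : N →ₗ[UsualNCA k (n - 1)] N')
        (z : NCATensor k n d hn N),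
        e N' (NCATensor.map k n d hn f z) =
          (f (e N z).1, fun i => IndRes.map k n f ((e N z).2 i))) := by
  obtain ⟨e, rfl⟩ : ∃ e, d = e + 2 := ⟨d - 2, by omega⟩
  obtain ⟨s, h⟩ := exists_isBraided (k := k) n hn
  have hbij := h.bijective_toRing (e := e) hn
  -- Both isomorphisms are inverses of explicit maps into R and R ⊗_A N; right linearity and
  -- naturality are checked for those maps and transported.
  refine ⟨⟨(LinearEquiv.ofBijective (Splitting.toRingLinear (topIncl k n (e + 2) hn) _
    (NCA.lastT_comm hn) e) hbij).symm, fun a y => ?_⟩, fun N _ _ => (LinearEquiv.ofBijective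
    (Splitting.toExtLinear (topIncl k n (e + 2) hn) _ (NCA.lastT_comm hn) e N)
    (Splitting.bijective_toExtLinear _ _ _ hbij)).symm, fun N N' _ _ _ _ f z => ?_⟩
  · rw [LinearEquiv.symm_apply_eq]
    obtain ⟨m, rfl⟩ := (LinearEquiv.ofBijective (Splitting.toRingLinear (topIncl k n (e + 2) hn) _
      (NCA.lastT_comm hn) e) hbij).surjective y
    rw [LinearEquiv.symm_apply_apply]
    exact (Splitting.toRing_op_smul _ _ (NCA.lastT_comm hn) a m).symm
  · rw [LinearEquiv.symm_apply_eq]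
    obtain ⟨m, rfl⟩ := (LinearEquiv.ofBijective
      (Splitting.toExtLinear (topIncl k n (e + 2) hn) _ (NCA.lastT_comm hn) e N)
      (Splitting.bijective_toExtLinear _ _ _ hbij)).surjective z
    rw [LinearEquiv.symm_apply_apply]
    exact (Splitting.toExtLinear_natural _ _ (NCA.lastT_comm hn) f m).symm
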